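/- Let $X_1, X_2, \ldots$ be independent random elements with common distribution $P$, taking values in a measurable space $E$ (for instance $\mathbb{R}^p$ or a separable metric space with its Borel sets). For each $m$ let $T_m(x_1,\ldots,x_m;P)$ be a symmetric statistic, possibly depending on $P$, and let $h$ be a bounded real function on the range of the statistics such that $h(T_m(\cdot\,;P))\colon E^m\to\mathbb{R}$ is measurable for every $m$. Put $$\theta_m(P) = \mathbb{E}_P\, h(T_m(X_1,\ldots,X_m;P)),\qquad J_m(P) = J_{m,n}(P) = \binom{n}{m}^{-1}\sum_{1\le i_1<\ldots<i_m\le n} h(T_m(X_{i_1},\ldots,X_{i_m};P)).$$ For a bounded measurable $f\colon E^N\to\mathbb{R}$, its Hoeffding decomposition with respect to $P^{\otimes N}$ is $f=\sum_{d=0}^N f_d$ with $f_d(x)=\sum_{|I|=d}h_I(x)$, $I\subset\{1,\ldots,N\}$, where $h_I=\big(\prod_{j\notin I}\mathbb{E}_j\prod_{l\in I}(\mathrm{Id}-\mathbb{E}_l)\big)f$ and $\mathbb{E}_j$ denotes integration over the $j$-th coordinate with respect to $P$; equivalently, $h_I$ depends only on $(x_i)_{i\in I}$ and integrates to $0$ in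 each of these coordinates. For $i\neq j$ set $$\mathfrak{d}_i f=\Big(\tfrac12\int (f-T_i^{y}f)^2\,P(dy)\Big)^{1/2},\qquad \mathfrak{d}_{ij}f=\Big(\tfrac14\iint (f-T_i^{y}f-T_j^{z}f+T_i^{y}T_j^{z}f)^2\,P(dy)P(dz)\Big)^{1/2},$$ where $T_i^{y}f(x)=f(x_1,\ldots,x_{i-1},y,x_{i+1},\ldots,x_N)$. Let $m=m(n)$ be such that $m\to\infty$ and $m/n\to0$ as $n\to\infty$. Write $h=\sum_{i=0}^m h_i$ for the Hoeffding decomposition of the function $h=h(T_m(x_1,\ldots,x_m;P))$ on $E^m$ with respect to $P^{\otimes m}$, and assume that there are constants $c_1,c_2$ not depending on $n$ such that for $m=m(n)$ and all $n$, $P^{\otimes m}$-almost everywhere, $$|\mathfrak{d}_{ij}h|\le\frac{c_1}{m}\quad(1\le i<j\le m),\qquad |\mathfrak{d}_i(h-h_0-h_1)|\le c_2\quad(1\le i\le m).$$ Let $J_{m,1}(P)$ be the first order Hoeffding term of $J_m(P)$, regarded as a function of $(X_1,\ldots,X_n)$. Then $$J_m(P)=\theta_m(P)+J_{m,1}(P)+\mathcal{O}_P\Big(\frac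 mn\Big)\qquad(n\to\infty),$$ that is, for every $\varepsilon>0$ there is $M$ such that $\mathbb{P}\big(|J_m(P)-\theta_m(P)-J_{m,1}(P)|>M\,m/n\big)\le\varepsilon$ for all sufficiently large $n$. -/

import Mathlib

open MeasureTheory ProbabilityTheory Filter Topology
open scoped ENNReal

noncomputable section

/-! ### Difference operators and Hoeffding decomposition on `E ^ n` with the product measure `P ^ n` -/

section DifferenceOperators

variable {E : Type*} [MeasurableSpace E] {n : ℕ}

/-- The first order `L²`-difference
`𝔡ᵢ f (x) = (1/2 ∫ (f x - f (x₁, …, xᵢ₋₁, y, xᵢ₊₁, …, xₙ))² P(dy)) ^ (1/2)`. -/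
def l2Diff (P : Measure E) (i : Fin n) (f : (Fin n → E) → ℝ) (x : Fin n → E) : ℝ :=
  Real.sqrt ((1 / 2) * ∫ y, (f x - f (Function.update x i y)) ^ 2 ∂P)

/-- The second order `L²`-difference (used for `i ≠ j`)
`𝔡ᵢⱼ f (x) = (1/4 ∫∫ (f - Tᵢ f - Tⱼ f + Tᵢⱼ f)² P(dy) P(dz)) ^ (1/2)`, where `Tᵢ` replaces the
coordinate `xᵢ` by `y`, `Tⱼ` replaces `xⱼ` by `z`, and `Tᵢⱼ` does both. -/
def l2Diff₂ (P : Measure E) (i j : Fin n) (f : (Fin n → E) → ℝ) (x : Fin n → E) : ℝ :=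
  Real.sqrt ((1 / 4) * ∫ y, ∫ z, (f x - f (Function.update x i y) - f (Function.update x j z)
    + f (Function.update (Function.update x i y) j z)) ^ 2 ∂P ∂P)

/-- Integrate out, with respect to `P`, all the coordinates outside `S`: this is the conditional
expectation `E (f(X) | X_i = x_i, i ∈ S)` for `X` with independent coordinates of law `P`. -/
def partialMean (P : Measure E) (f : (Fin n → E) → ℝ) (S : Finset (Fin n)) (x : Fin n → E) : ℝ :=
  ∫ y, f (S.piecewise x y) ∂(Measure.pi fun _ : Fin n => P)

/-- The component `h_I (x_i, i ∈ I) = (∏_{j ∉ I} E_j ∏_{l ∈ I} (Id - E_l)) f` of the Hoeffding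
decomposition `f = ∑_I h_I`, with the product expanded; `E_i` integrates out the `i`-th coordinate. -/
def hoeffdingComponent (P : Measure E) (f : (Fin n → E) → ℝ) (I : Finset (Fin n))
    (x : Fin n → E) : ℝ :=
  ∑ S ∈ I.powerset, (-1) ^ (I.card - S.card) * partialMean P f S x

/-- The Hoeffding term of degree `d`, `f_d = ∑_{|I| = d} h_I`. -/
def hoeffdingTerm (P : Measure E) (f : (Fin n → E) → ℝ) (d : ℕ) (x : Fin n → E) : ℝ :=
  ∑ I ∈ Finset.powersetCard d Finset.univ, hoeffdingComponent P f I x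

end DifferenceOperators

/-! ### The `m` out of `n` bootstrap without replacement -/

/-- For a kernel `k` in `m` variables and a sample `x = (x₁, …, xₙ)`, the average
`(n choose m)⁻¹ ∑_{i₁ < … < i_m} k (x_{i₁}, …, x_{i_m})`. -/
def subsampleMean {E : Type*} {m : ℕ} (k : (Fin m → E) → ℝ) (n : ℕ) (x : Fin n → E) : ℝ :=
  (n.choose m : ℝ)⁻¹ * ∑ φ : Fin m ↪o Fin n, k fun j => x (φ j)

/-- `Y n = O_P (a n)` as `n → ∞`. -/
def IsBigOInProb {Ω : Type*} [MeasurableSpace Ω] (μ : Measure Ω) (Y : ℕ → Ω → ℝ) (a : ℕ → ℝ) :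
    Prop :=
  ∀ ε : ℝ≥0∞, 0 < ε → ∃ M : ℝ, ∀ᶠ n in atTop, μ {ω | M * |a n| < |Y n ω|} ≤ ε

section Bootstrap

variable {E S : Type*} [MeasurableSpace E]

/-- The function `(x₁, …, x_m) ↦ h (T_m (x₁, …, x_m; P))`. -/
def statKernel (h : S → ℝ) (T : (m : ℕ) → (Fin m → E) → Measure E → S) (P : Measure E) (m : ℕ)
    (x : Fin m → E) : ℝ :=
  h (T m x P)

/-- `θ_m (P) = E_P h (T_m (X₁, …, X_m; P))`. -/
def bootTheta (h : S → ℝ) (T : (m : ℕ) → (Fin m → E) → Measure E → S) (P : Measure E) (m : ℕ) :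
    ℝ :=
  ∫ x, statKernel h T P m x ∂(Measure.pi fun _ : Fin m => P)

/-- `J_{m,n} (P) = (n choose m)⁻¹ ∑_{i₁ < … < i_m} h (T_m (x_{i₁}, …, x_{i_m}; P))` as a function
of the sample `x = (x₁, …, xₙ)`. -/
def bootJ (h : S → ℝ) (T : (m : ℕ) → (Fin m → E) → Measure E → S) (P : Measure E) (m n : ℕ)
    (x : Fin n → E) : ℝ :=
  subsampleMean (statKernel h T P m) n x

end Bootstrap

end

/-! The error `J - θ - J₁` is the part of order at least two of the Hoeffding decomposition of `J`,
and its second moment is at most `(C m/n)²` when `|h| ≤ C`; Chebyshev then finishes. Distinct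
components are orthogonal, so this moment is the sum of `‖J_I‖²` over `|I| ≥ 2`. Only subsamples
containing `I` contribute to `J_I`, at most `D = (n-2 choose m-2)` of the `B = (n choose m)`. By
Cauchy–Schwarz, `‖J_I‖²` is at most `B⁻² D` times the sum over all subsamples of the squared norms
of their `I`-components. Summing over `I`, Parseval bounds each subsample's share by `C²`, leaving
`(D/B) C² ≤ (m/n)² C²`. The lemmas carrying this are `integral_hoeffdingComponent_mul`,
`hoeffdingComponent_subsampleMean` and `integral_sq_subsampleMean_remainder_le`. -/

/-! ### Hoeffding components: orthogonality, reconstruction, Parseval -/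

section HoeffdingDecomposition

variable {E : Type*} [MeasurableSpace E] {n : ℕ}

/-- Bounded measurable real functions. -/
def BddMeasurable {α : Type*} [MeasurableSpace α] (f : α → ℝ) : Prop :=
  Measurable f ∧ ∃ C : ℝ, ∀ x, |f x| ≤ C

namespace BddMeasurable

variable {α β : Type*} [MeasurableSpace α] [MeasurableSpace β] {f g : α → ℝ}

theorem integrable (hf : BddMeasurable f) (μ : Measure α) [IsFiniteMeasure μ] :
    Integrable f μ := by
  obtain ⟨hm, C, hC⟩ := hf
  exact Integrable.of_bound hm.aestronglyMeasurable C (Eventually.of_forall hC)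

theorem const (c : ℝ) : BddMeasurable fun _ : α => c :=
  ⟨measurable_const, |c|, fun _ => le_rfl⟩

theorem add (hf : BddMeasurable f) (hg : BddMeasurable g) :
    BddMeasurable fun x => f x + g x := by
  obtain ⟨hm, C, hC⟩ := hf
  obtain ⟨hm', C', hC'⟩ := hg
  exact ⟨hm.add hm', C + C', fun x => (abs_add_le _ _).trans (add_le_add (hC x) (hC' x))⟩

theorem mul (hf : BddMeasurable f) (hg : BddMeasurable g) :
    BddMeasurable fun x => f x * g x := by
  obtain ⟨hm, C, hC⟩ := hf
  obtain ⟨hm', C', hC'⟩ := hg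
  refine ⟨hm.mul hm', C * C', fun x => ?_⟩
  rw [abs_mul]
  exact mul_le_mul (hC x) (hC' x) (abs_nonneg _) ((abs_nonneg _).trans (hC x))

theorem const_mul (hf : BddMeasurable f) (c : ℝ) : BddMeasurable fun x => c * f x :=
  (const c).mul hf

theorem sq (hf : BddMeasurable f) : BddMeasurable fun x => f x ^ 2 := by
  simpa only [pow_two] using hf.mul hf

theorem sum {ι : Type*} {s : Finset ι} {F : ι → α → ℝ} (hF : ∀ i ∈ s, BddMeasurable (F i)) :
    BddMeasurable fun x => ∑ i ∈ s, F i x := by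
  classical
  induction s using Finset.induction_on with
  | empty => simpa using const 0
  | insert i s his ih =>
    simp only [Finset.sum_insert his]
    exact (hF i (by simp)).add (ih fun j hj => hF j (by simp [hj]))

theorem comp (hf : BddMeasurable f) {u : β → α} (hu : Measurable u) :
    BddMeasurable fun x => f (u x) := by
  obtain ⟨hm, C, hC⟩ := hf
  exact ⟨hm.comp hu, C, fun x => hC _⟩

theorem integral_right {F : α × β → ℝ} (hF : BddMeasurable F) (ν : Measure β)
    [IsProbabilityMeasure ν] : BddMeasurable fun x => ∫ y, F (x, y) ∂ν := by
  obtain ⟨hm, C, hC⟩ := hF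
  refine ⟨hm.stronglyMeasurable.integral_prod_right'.measurable, C, fun x => ?_⟩
  simpa using norm_integral_le_of_norm_le_const (μ := ν) (f := fun y => F (x, y))
    (Eventually.of_forall fun y => hC (x, y))

end BddMeasurable

theorem measurable_finset_piecewise (S : Finset (Fin n)) :
    Measurable fun p : (Fin n → E) × (Fin n → E) => S.piecewise p.1 p.2 := by
  refine measurable_pi_lambda _ fun i => ?_
  by_cases hi : i ∈ S
  · simpa [hi] using measurable_pi_iff.1 measurable_fst i
  · simpa [hi] using measurable_pi_iff.1 measurable_snd i

/-- Gluing two independent samples along `S` gives a sample. -/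
theorem measurePreserving_finset_piecewise (P : Measure E) [IsProbabilityMeasure P]
    (S : Finset (Fin n)) :
    MeasurePreserving (fun p : (Fin n → E) × (Fin n → E) => S.piecewise p.1 p.2)
      ((Measure.pi fun _ => P).prod (Measure.pi fun _ => P)) (Measure.pi fun _ => P) := by
  refine ⟨measurable_finset_piecewise S, (Measure.pi_eq fun s hs => ?_).symm⟩
  rw [Measure.map_apply (measurable_finset_piecewise S) (MeasurableSet.univ_pi hs)]
  have : (fun p : (Fin n → E) × (Fin n → E) => S.piecewise p.1 p.2) ⁻¹' Set.univ.pi s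
      = (Set.univ.pi fun i => if i ∈ S then s i else Set.univ) ×ˢ
        (Set.univ.pi fun i => if i ∈ S then Set.univ else s i) := by
    ext ⟨x, y⟩
    simp only [Set.mem_preimage, Set.mem_univ_pi, Set.mem_prod, ← forall_and]
    refine forall_congr' fun i => ?_
    by_cases hi : i ∈ S <;> simp [Finset.piecewise, hi]
  rw [this, Measure.prod_prod, Measure.pi_pi, Measure.pi_pi, ← Finset.prod_mul_distrib]
  refine Finset.prod_congr rfl fun i _ => ?_
  by_cases hi : i ∈ S <;> simp [hi]

/-- The terms of `S` and `insert i S` cancel in pairs. Both vanishing statements about components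
reduce to this. -/
theorem sum_powerset_alternating_eq_zero {ι : Type*} [DecidableEq ι] {I : Finset ι} {i : ι}
    (hi : i ∈ I) {a : Finset ι → ℝ} (ha : ∀ S, a (insert i S) = a S) :
    ∑ S ∈ I.powerset, (-1 : ℝ) ^ (I.card - S.card) * a S = 0 := by
  obtain ⟨J, hiJ, rfl⟩ : ∃ J, i ∉ J ∧ insert i J = I :=
    ⟨I.erase i, by simp, Finset.insert_erase hi⟩
  rw [Finset.sum_powerset_insert hiJ, ← Finset.sum_add_distrib]
  refine Finset.sum_eq_zero fun S hS => ?_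
  have hSJ := Finset.mem_powerset.1 hS
  have hle := Finset.card_le_card hSJ
  rw [ha, Finset.card_insert_of_notMem hiJ, Finset.card_insert_of_notMem fun h => hiJ (hSJ h),
    Nat.add_sub_add_right, Nat.sub_add_comm hle, pow_succ]
  ring

variable (P : Measure E) {f : (Fin n → E) → ℝ}

/-- The Hoeffding component over `I` vanishes if the function ignores a coordinate in `I`. -/
theorem hoeffdingComponent_eq_zero {I : Finset (Fin n)} {i : Fin n} (hi : i ∈ I)
    (hf : ∀ x y : Fin n → E, (∀ j, j ≠ i → x j = y j) → f x = f y) (x : Fin n → E) :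
    hoeffdingComponent P f I x = 0 := by
  refine sum_powerset_alternating_eq_zero hi fun S => ?_
  unfold partialMean
  congr! 2 with y
  refine hf _ _ fun j hj => ?_
  by_cases hS : j ∈ S <;> simp [Finset.piecewise, hj, hS]

theorem hoeffdingComponent_piecewise (I : Finset (Fin n)) (x y : Fin n → E) :
    hoeffdingComponent P f I (I.piecewise x y) = hoeffdingComponent P f I x := by
  unfold hoeffdingComponent partialMean
  refine Finset.sum_congr rfl fun S hS => ?_
  congr! 4 with z
  ext i
  by_cases hi : i ∈ S
  · simp [Finset.piecewise, hi, Finset.mem_powerset.1 hS hi]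
  · simp [Finset.piecewise, hi]

theorem hoeffdingComponent_empty (x : Fin n → E) :
    hoeffdingComponent P f ∅ x = ∫ y, f y ∂(Measure.pi fun _ => P) := by
  simp [hoeffdingComponent, partialMean]

variable [IsProbabilityMeasure P]

theorem BddMeasurable.partialMean (hf : BddMeasurable f) (S : Finset (Fin n)) :
    BddMeasurable (partialMean P f S) :=
  (hf.comp (measurable_finset_piecewise S)).integral_right _

theorem BddMeasurable.hoeffdingComponent (hf : BddMeasurable f) (I : Finset (Fin n)) :
    BddMeasurable (hoeffdingComponent P f I) :=
  BddMeasurable.sum fun S _ => (hf.partialMean P S).const_mul _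

theorem integral_piecewise (hf : BddMeasurable f) (S : Finset (Fin n)) :
    ∫ x, ∫ y, f (S.piecewise x y) ∂(Measure.pi fun _ => P) ∂(Measure.pi fun _ => P)
      = ∫ x, f x ∂(Measure.pi fun _ => P) := by
  have hmp := measurePreserving_finset_piecewise (n := n) P S
  conv_rhs => rw [← hmp.map_eq]
  rw [integral_map hmp.aemeasurable hf.1.aestronglyMeasurable,
    integral_prod _ ((hf.comp (measurable_finset_piecewise S)).integrable _)]

theorem integral_partialMean (hf : BddMeasurable f) (S : Finset (Fin n)) :
    ∫ x, partialMean P f S x ∂(Measure.pi fun _ => P) = ∫ x, f x ∂(Measure.pi fun _ => P) :=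
  integral_piecewise P hf S

/-- The two auxiliary samples, glued along `S`, form one fresh sample, of which only the coordinates
outside `S ∩ T` are used. -/
theorem partialMean_partialMean (hf : BddMeasurable f) (S T : Finset (Fin n)) (x : Fin n → E) :
    partialMean P (partialMean P f S) T x = partialMean P f (S ∩ T) x := by
  have h := integral_piecewise P (hf.comp (u := fun z => (S ∩ T).piecewise x z)
    ((measurable_finset_piecewise (S ∩ T)).comp (measurable_const.prodMk measurable_id))) S
  rw [partialMean, partialMean, ← h]
  unfold partialMean
  refine integral_congr_ae (Eventually.of_forall fun y =>
    integral_congr_ae (Eventually.of_forall fun z => congrArg f ?_))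
  ext i
  by_cases hS : i ∈ S <;> by_cases hT : i ∈ T <;> simp [hS, hT]

theorem partialMean_finset_sum {ι : Type*} (s : Finset ι) (c : ι → ℝ)
    {F : ι → (Fin n → E) → ℝ} (hF : ∀ i ∈ s, BddMeasurable (F i)) (S : Finset (Fin n))
    (x : Fin n → E) :
    partialMean P (fun x => ∑ i ∈ s, c i * F i x) S x = ∑ i ∈ s, c i * partialMean P (F i) S x := by
  unfold partialMean
  rw [integral_finsetSum]
  · simp_rw [integral_const_mul]
  · intro i hi
    exact (((hF i hi).comp ((measurable_finset_piecewise S).comp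
      (measurable_const.prodMk measurable_id))).integrable _).const_mul _

theorem hoeffdingComponent_finset_sum {ι : Type*} (s : Finset ι) (c : ι → ℝ)
    {F : ι → (Fin n → E) → ℝ} (hF : ∀ i ∈ s, BddMeasurable (F i)) (I : Finset (Fin n))
    (x : Fin n → E) :
    hoeffdingComponent P (fun x => ∑ i ∈ s, c i * F i x) I x
      = ∑ i ∈ s, c i * hoeffdingComponent P (F i) I x := by
  unfold hoeffdingComponent
  simp_rw [partialMean_finset_sum P s c hF, Finset.mul_sum]
  rw [Finset.sum_comm]
  refine Finset.sum_congr rfl fun i _ => Finset.sum_congr rfl fun S _ => ?_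
  ring

/-- For `i ∈ I \ J`, adding `i` to `S` does not change `S ∩ J`, so the alternating sum cancels. -/
theorem partialMean_hoeffdingComponent_eq_zero (hf : BddMeasurable f) {I J : Finset (Fin n)}
    (hIJ : ¬ I ⊆ J) (x : Fin n → E) :
    partialMean P (hoeffdingComponent P f I) J x = 0 := by
  obtain ⟨i, hi, hiJ⟩ := Finset.not_subset.1 hIJ
  have := partialMean_finset_sum P I.powerset (fun S => (-1 : ℝ) ^ (I.card - S.card))
    (fun S _ => hf.partialMean P S) J x
  change partialMean P (fun x => ∑ S ∈ I.powerset, _) J x = 0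
  rw [this]
  refine sum_powerset_alternating_eq_zero hi fun S => ?_
  rw [partialMean_partialMean P hf, partialMean_partialMean P hf, Finset.insert_inter_of_notMem hiJ]

/-- Conditionally on the coordinates in `J`, the component over `J` is a constant factor and the one
over `I` has mean zero. -/
theorem integral_hoeffdingComponent_mul_of_not_subset (hf : BddMeasurable f)
    {I J : Finset (Fin n)} (hIJ : ¬ I ⊆ J) :
    ∫ x, hoeffdingComponent P f J x * hoeffdingComponent P f I x ∂(Measure.pi fun _ => P) = 0 := by
  rw [← integral_partialMean P ((hf.hoeffdingComponent P J).mul (hf.hoeffdingComponent P I)) J]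
  refine integral_eq_zero_of_ae (Eventually.of_forall fun x => ?_)
  unfold partialMean
  simp_rw [hoeffdingComponent_piecewise, integral_const_mul]
  exact mul_eq_zero_of_right _ (partialMean_hoeffdingComponent_eq_zero P hf hIJ x)

/-- Distinct Hoeffding components are orthogonal. -/
theorem integral_hoeffdingComponent_mul (hf : BddMeasurable f) {I J : Finset (Fin n)}
    (hIJ : I ≠ J) :
    ∫ x, hoeffdingComponent P f I x * hoeffdingComponent P f J x ∂(Measure.pi fun _ => P) = 0 := by
  by_cases h : J ⊆ I
  · have h' : ¬ I ⊆ J := fun h' => hIJ (h'.antisymm h)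
    simp_rw [mul_comm (hoeffdingComponent P f I _)]
    exact integral_hoeffdingComponent_mul_of_not_subset P hf h'
  · exact integral_hoeffdingComponent_mul_of_not_subset P hf h

theorem integral_sq_sum_hoeffdingComponent (hf : BddMeasurable f)
    (A : Finset (Finset (Fin n))) :
    ∫ x, (∑ I ∈ A, hoeffdingComponent P f I x) ^ 2 ∂(Measure.pi fun _ => P)
      = ∑ I ∈ A, ∫ x, hoeffdingComponent P f I x ^ 2 ∂(Measure.pi fun _ => P) := by
  have hint : ∀ I J, Integrable
      (fun x => hoeffdingComponent P f I x * hoeffdingComponent P f J x)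
      (Measure.pi fun _ => P) := fun I J =>
    ((hf.hoeffdingComponent P I).mul (hf.hoeffdingComponent P J)).integrable _
  simp_rw [pow_two, Finset.sum_mul_sum]
  rw [integral_finsetSum _ fun I _ => integrable_finsetSum _ fun J _ => hint I J]
  refine Finset.sum_congr rfl fun I hI => ?_
  rw [integral_finsetSum _ fun J _ => hint I J]
  exact Finset.sum_eq_single I (fun J _ hJ => integral_hoeffdingComponent_mul P hf hJ.symm)
    fun h => absurd hI h

theorem partialMean_univ (x : Fin n → E) : partialMean P f Finset.univ x = f x := by
  simp [partialMean]

/-- A function is the sum of its Hoeffding components. -/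
theorem sum_hoeffdingComponent (x : Fin n → E) :
    ∑ I : Finset (Fin n), hoeffdingComponent P f I x = f x := by
  unfold hoeffdingComponent
  -- Writing `I = S ∪ R` with `R ⊆ Sᶜ` isolates the coefficient of each partial mean: an alternating
  -- sum over subsets of `Sᶜ`, which is zero unless `S` is everything.
  have hswap : ∑ I : Finset (Fin n), ∑ S ∈ I.powerset,
      (-1 : ℝ) ^ (I.card - S.card) * partialMean P f S x
      = ∑ S : Finset (Fin n), ∑ R ∈ Sᶜ.powerset, (-1 : ℝ) ^ R.card * partialMean P f S x := by
    rw [Finset.sum_sigma', Finset.sum_sigma']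
    refine Finset.sum_bij' (fun p _ => ⟨p.2, p.1 \ p.2⟩) (fun p _ => ⟨p.1 ∪ p.2, p.1⟩) ?_ ?_ ?_ ?_ ?_
    · rintro ⟨I, S⟩ _
      simp only [Finset.mem_sigma, Finset.mem_univ, Finset.mem_powerset, true_and]
      intro i hi
      simpa using (Finset.mem_sdiff.1 hi).2
    · rintro ⟨S, R⟩ _
      simp only [Finset.mem_sigma, Finset.mem_univ, Finset.mem_powerset, true_and]
      exact Finset.subset_union_left
    · rintro ⟨I, S⟩ h
      simp only [Finset.mem_sigma, Finset.mem_univ, Finset.mem_powerset, true_and] at h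
      simp [Finset.union_sdiff_of_subset h]
    · rintro ⟨S, R⟩ h
      simp only [Finset.mem_sigma, Finset.mem_univ, Finset.mem_powerset, true_and] at h
      have : Disjoint R S := Finset.subset_compl_iff_disjoint_right.1 h
      simp [Finset.union_sdiff_cancel_left this.symm]
    · rintro ⟨I, S⟩ h
      simp only [Finset.mem_sigma, Finset.mem_univ, Finset.mem_powerset, true_and] at h
      rw [Finset.card_sdiff_of_subset h]
  rw [hswap, Finset.sum_eq_single Finset.univ]
  · simp [partialMean_univ]
  · intro S _ hS
    rw [← Finset.sum_mul]
    have : ∑ R ∈ Sᶜ.powerset, (-1 : ℤ) ^ R.card = 0 := by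
      rw [Finset.sum_powerset_neg_one_pow_card, if_neg (by simpa using hS)]
    rw [show ∑ R ∈ Sᶜ.powerset, (-1 : ℝ) ^ R.card = 0 by exact_mod_cast this, zero_mul]
  · simp

theorem sum_integral_sq_hoeffdingComponent_le (hf : Measurable f) {C : ℝ} (hC : ∀ x, |f x| ≤ C) :
    ∑ I : Finset (Fin n), ∫ x, hoeffdingComponent P f I x ^ 2 ∂(Measure.pi fun _ => P)
      ≤ C ^ 2 := by
  have hf' : BddMeasurable f := ⟨hf, C, hC⟩
  rw [← integral_sq_sum_hoeffdingComponent P hf' Finset.univ]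
  simp_rw [sum_hoeffdingComponent]
  have := integral_mono (hf'.sq.integrable (Measure.pi fun _ => P)) (integrable_const (C ^ 2))
    fun x => sq_le_sq' (abs_le.1 (hC x)).1 (abs_le.1 (hC x)).2
  simpa using this

end HoeffdingDecomposition

/-! ### Subsample means: counting and the second moment of the remainder -/

section Subsample

theorem card_orderEmbedding_fin (m n : ℕ) : Fintype.card (Fin m ↪o Fin n) = n.choose m := by
  rw [← Nat.card_eq_fintype_card, Nat.card_congr Set.powersetCard.ofFinEmbEquiv,
    Set.powersetCard.card, Nat.card_eq_fintype_card, Fintype.card_fin]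

/-- At most `(n - 2 choose m - 2)` of the increasing `m`-tuples contain two given indices. -/
theorem card_orderEmbedding_fin_filter_le {m n : ℕ} (I : Finset (Fin n)) (hI : 2 ≤ I.card) :
    (Finset.univ.filter fun φ : Fin m ↪o Fin n => ∀ i ∈ I, i ∈ Set.range φ).card
      ≤ (n - 2).choose (m - 2) := by
  obtain ⟨J, hJI, hJ⟩ := Finset.exists_subset_card_eq hI
  have : ((Finset.univ \ J).powersetCard (m - 2)).card = (n - 2).choose (m - 2) := by
    rw [Finset.card_powersetCard, Finset.card_sdiff_of_subset (Finset.subset_univ _), hJ,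
      Finset.card_univ, Fintype.card_fin]
  rw [← this]
  have hsub : ∀ φ : Fin m ↪o Fin n, (∀ i ∈ I, i ∈ Set.range φ) →
      J ⊆ Finset.univ.map φ.toEmbedding := fun φ h i hi => by simpa using h i (hJI hi)
  -- An increasing tuple is determined by its range, hence, once the range contains the pair `J`, by
  -- the other `m - 2` indices.
  refine Finset.card_le_card_of_injOn (fun φ => Finset.univ.map φ.toEmbedding \ J) ?_ ?_
  · intro φ hφ
    simp only [Finset.coe_filter, Finset.mem_univ, true_and, Set.mem_ofPred_eq] at hφ
    simp only [Finset.mem_coe, Finset.mem_powersetCard]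
    refine ⟨Finset.sdiff_subset_sdiff (Finset.subset_univ _) le_rfl, ?_⟩
    rw [Finset.card_sdiff_of_subset (hsub φ hφ), hJ, Finset.card_map, Finset.card_univ,
      Fintype.card_fin]
  · intro φ hφ ψ hψ h
    simp only [Finset.coe_filter, Finset.mem_univ, true_and, Set.mem_ofPred_eq] at hφ hψ
    have h' : Finset.univ.map φ.toEmbedding = Finset.univ.map ψ.toEmbedding := by
      rw [← Finset.union_sdiff_of_subset (hsub φ hφ), ← Finset.union_sdiff_of_subset (hsub ψ hψ)]
      exact congrArg (J ∪ ·) h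
    refine OrderEmbedding.range_inj.1 ?_
    simpa using congrArg (fun s : Finset (Fin n) => (s : Set (Fin n))) h'

/-- The ratio of the binomials is `m(m-1) / (n(n-1))`, and `(m-1)/(n-1) ≤ m/n` because `m ≤ n`. -/
theorem choose_sub_two_le {m n : ℕ} (hm : 2 ≤ m) (hmn : m ≤ n) :
    ((n - 2).choose (m - 2) : ℝ) ≤ (m / n : ℝ) ^ 2 * n.choose m := by
  obtain ⟨k, rfl⟩ := Nat.exists_eq_add_of_le' hm
  obtain ⟨l, rfl⟩ := Nat.exists_eq_add_of_le' (hm.trans hmn)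
  have h1 := Nat.add_one_mul_choose_eq (l + 1) (k + 1)
  have h2 := Nat.add_one_mul_choose_eq l k
  have hkl : (k : ℝ) ≤ l := by exact_mod_cast (by omega : k ≤ l)
  have h1' : ((l : ℝ) + 2) * (l + 1).choose (k + 1) = (l + 2).choose (k + 2) * (k + 2) := by
    have := congrArg (Nat.cast (R := ℝ)) h1
    push_cast at this
    linarith
  have h2' : ((l : ℝ) + 1) * l.choose k = (l + 1).choose (k + 1) * (k + 1) := by
    exact_mod_cast h2
  simp only [Nat.add_sub_cancel]
  push_cast
  rw [div_pow, div_mul_eq_mul_div, le_div_iff₀ (by positivity)]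
  have hb : (0 : ℝ) ≤ (l + 1).choose (k + 1) := by positivity
  have hc : (0 : ℝ) ≤ l.choose k := by positivity
  -- This is `(k+1)/(l+1) ≤ (k+2)/(l+2)` in binomial form: `h2'` plus one application of Pascal's
  -- rule.
  have h3 : (l.choose k : ℝ) * (l + 2) ≤ (l + 1).choose (k + 1) * (k + 2) := by
    have : (l.choose k : ℝ) ≤ (l + 1).choose (k + 1) := by
      exact_mod_cast Nat.choose_succ_succ l k ▸ Nat.le_add_right _ _
    linarith
  calc (l.choose k : ℝ) * (l + 2) ^ 2 = (l.choose k * (l + 2)) * (l + 2) := by ring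
    _ ≤ ((l + 1).choose (k + 1) * (k + 2)) * (l + 2) := by gcongr
    _ = (k + 2) * ((l + 2) * (l + 1).choose (k + 1)) := by ring
    _ = (k + 2) ^ 2 * (l + 2).choose (k + 2) := by rw [h1']; ring

variable {E : Type*} [MeasurableSpace E] {m n : ℕ}

theorem measurable_comp_orderEmbedding (φ : Fin m ↪o Fin n) :
    Measurable fun (x : Fin n → E) j => x (φ j) :=
  measurable_pi_lambda _ fun _ => measurable_pi_apply _

/-- The law of finitely many coordinates of an independent family with common law `P`. -/
theorem map_comp_injective_eq_pi (P : Measure E) {ι Ω : Type*} [MeasurableSpace Ω] {μ : Measure Ω}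
    [IsProbabilityMeasure μ] {X : ι → Ω → E} (hX : ∀ i, HasLaw (X i) P μ) (hind : iIndepFun X μ)
    {φ : Fin m → ι} (hφ : Function.Injective φ) :
    μ.map (fun ω j => X (φ j) ω) = Measure.pi fun _ => P := by
  rw [(iIndepFun_iff_map_fun_eq_pi_map fun j => (hX (φ j)).aemeasurable).1 (hind.precomp hφ)]
  simp_rw [(hX _).map_eq]

variable {k : (Fin m → E) → ℝ}

theorem BddMeasurable.subsampleMean (hk : BddMeasurable k) :
    BddMeasurable (subsampleMean k n) :=
  (BddMeasurable.sum fun φ _ => hk.comp (measurable_comp_orderEmbedding φ)).const_mul _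

variable (P : Measure E) [IsProbabilityMeasure P]

/-- By linearity; a subsample missing some index of `I` ignores that coordinate, so its component
over `I` vanishes. -/
theorem hoeffdingComponent_subsampleMean (hk : BddMeasurable k) (I : Finset (Fin n))
    (x : Fin n → E) :
    hoeffdingComponent P (subsampleMean k n) I x
      = (n.choose m : ℝ)⁻¹ * ∑ φ ∈ Finset.univ.filter
          (fun φ : Fin m ↪o Fin n => ∀ i ∈ I, i ∈ Set.range φ),
        hoeffdingComponent P (fun y => k fun j => y (φ j)) I x := by
  have h := hoeffdingComponent_finset_sum P Finset.univ (fun _ => (n.choose m : ℝ)⁻¹)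
    (F := fun (φ : Fin m ↪o Fin n) y => k fun j => y (φ j))
    (fun φ _ => hk.comp (measurable_comp_orderEmbedding φ)) I x
  have e : subsampleMean k n
      = fun y => ∑ φ : Fin m ↪o Fin n, (n.choose m : ℝ)⁻¹ * k fun j => y (φ j) := by
    ext y
    rw [subsampleMean, Finset.mul_sum]
  rw [e, h, ← Finset.mul_sum]
  congr 1
  refine (Finset.sum_filter_of_ne fun φ _ hne i hi => ?_).symm
  by_contra hr
  refine hne (hoeffdingComponent_eq_zero P hi (fun y z hyz => ?_) x)
  congr 1
  ext j
  exact hyz _ fun hj => hr ⟨j, hj⟩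

/-- The part of order at least two of the Hoeffding decomposition of a subsample mean. -/
theorem integral_sq_subsampleMean_remainder_le (hk : Measurable k) {C : ℝ}
    (hC : ∀ x, |k x| ≤ C) (hm : 2 ≤ m) (hmn : m ≤ n) :
    ∫ x, (∑ I : Finset (Fin n) with 2 ≤ I.card,
        hoeffdingComponent P (subsampleMean k n) I x) ^ 2 ∂(Measure.pi fun _ => P)
      ≤ (C * (m / n)) ^ 2 := by
  have hk' : BddMeasurable k := ⟨hk, C, hC⟩
  have hφ : ∀ φ : Fin m ↪o Fin n, BddMeasurable fun (y : Fin n → E) => k fun j => y (φ j) :=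
    fun φ => hk'.comp (measurable_comp_orderEmbedding φ)
  rw [integral_sq_sum_hoeffdingComponent P hk'.subsampleMean]
  set B : ℝ := (n.choose m : ℝ) with hB
  have hBpos : 0 < B := Nat.cast_pos.2 (Nat.choose_pos hmn)
  set D : ℝ := ((n - 2).choose (m - 2) : ℝ) with hD
  have hD0 : 0 ≤ D := by positivity
  set V : (Fin m ↪o Fin n) → Finset (Fin n) → ℝ := fun φ I =>
    ∫ x, hoeffdingComponent P (fun y => k fun j => y (φ j)) I x ^ 2 ∂(Measure.pi fun _ => P)
  have hV0 : ∀ φ I, 0 ≤ V φ I := fun φ I => integral_nonneg fun x => sq_nonneg _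
  have hcomp : ∀ I : Finset (Fin n), 2 ≤ I.card →
      ∫ x, hoeffdingComponent P (subsampleMean k n) I x ^ 2 ∂(Measure.pi fun _ => P)
        ≤ (B⁻¹) ^ 2 * D * ∑ φ, V φ I := by
    intro I hI
    have hint : ∀ φ : Fin m ↪o Fin n, Integrable
        (fun x => hoeffdingComponent P (fun y => k fun j => y (φ j)) I x ^ 2)
        (Measure.pi fun _ => P) := fun φ => ((hφ φ).hoeffdingComponent P I).sq.integrable _
    rw [← integral_finsetSum _ fun φ _ => hint φ, ← integral_const_mul]
    refine integral_mono ((hk'.subsampleMean.hoeffdingComponent P I).sq.integrable _)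
      ((integrable_finsetSum _ fun φ _ => hint φ).const_mul _) fun x => ?_
    dsimp only
    rw [hoeffdingComponent_subsampleMean P hk', mul_pow, mul_assoc]
    -- Cauchy–Schwarz is applied to the restricted sum, so that its cardinality factor is `D` rather
    -- than `B`; only then is the sum enlarged to all `φ`.
    refine mul_le_mul_of_nonneg_left (sq_sum_le_card_mul_sum_sq.trans ?_) (sq_nonneg _)
    refine mul_le_mul ?_ (Finset.sum_le_sum_of_subset_of_nonneg (Finset.filter_subset _ _)
      fun _ _ _ => sq_nonneg _) (Finset.sum_nonneg fun _ _ => sq_nonneg _) hD0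
    rw [hD]
    exact_mod_cast card_orderEmbedding_fin_filter_le I hI
  -- Enlarging to all `I` costs nothing essential: after exchanging the sums, Parseval gives `C²`
  -- for each of the `B` embeddings.
  calc ∑ I : Finset (Fin n) with 2 ≤ I.card,
        ∫ x, hoeffdingComponent P (subsampleMean k n) I x ^ 2 ∂(Measure.pi fun _ => P)
      ≤ ∑ I : Finset (Fin n) with 2 ≤ I.card, (B⁻¹) ^ 2 * D * ∑ φ, V φ I :=
        Finset.sum_le_sum fun I hI => hcomp I (Finset.mem_filter.1 hI).2
    _ ≤ ∑ I : Finset (Fin n), (B⁻¹) ^ 2 * D * ∑ φ, V φ I :=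
        Finset.sum_le_sum_of_subset_of_nonneg (Finset.filter_subset _ _) fun I _ _ =>
          mul_nonneg (mul_nonneg (sq_nonneg _) hD0) (Finset.sum_nonneg fun φ _ => hV0 φ I)
    _ = (B⁻¹) ^ 2 * D * ∑ φ, ∑ I, V φ I := by rw [← Finset.mul_sum, Finset.sum_comm]
    _ ≤ (B⁻¹) ^ 2 * D * ∑ _φ : Fin m ↪o Fin n, C ^ 2 := by
        gcongr with φ
        exact sum_integral_sq_hoeffdingComponent_le P (hφ φ).1 fun x => hC _
    _ = B⁻¹ * D * C ^ 2 := by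
        rw [Finset.sum_const, Finset.card_univ, card_orderEmbedding_fin, nsmul_eq_mul, ← hB]
        field_simp
    _ ≤ B⁻¹ * ((m / n : ℝ) ^ 2 * B) * C ^ 2 := by
        gcongr
        exact choose_sub_two_le hm hmn
    _ = (C * (m / n)) ^ 2 := by field_simp

theorem integral_subsampleMean (hk : BddMeasurable k) (hmn : m ≤ n) :
    ∫ x, subsampleMean k n x ∂(Measure.pi fun _ => P) = ∫ x, k x ∂(Measure.pi fun _ => P) := by
  have hφ : ∀ φ : Fin m ↪o Fin n,
      ∫ x : Fin n → E, k (fun j => x (φ j)) ∂(Measure.pi fun _ => P)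
        = ∫ x, k x ∂(Measure.pi fun _ => P) := by
    intro φ
    rw [← map_comp_injective_eq_pi P (μ := Measure.pi fun _ : Fin n => P)
      (X := fun i x => x i) (fun i => (measurePreserving_eval (fun _ => P) i).hasLaw)
      (iIndepFun_pi (X := fun _ => id) fun _ => aemeasurable_id) φ.injective,
      integral_map (measurable_comp_orderEmbedding φ).aemeasurable hk.1.aestronglyMeasurable]
  unfold subsampleMean
  rw [integral_const_mul, integral_finsetSum _ fun φ _ =>
    (hk.comp (measurable_comp_orderEmbedding φ)).integrable _]
  simp_rw [hφ]
  rw [Finset.sum_const, Finset.card_univ, card_orderEmbedding_fin, nsmul_eq_mul, ← mul_assoc,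
    inv_mul_cancel₀, one_mul]
  exact Nat.cast_ne_zero.2 (Nat.choose_pos hmn).ne'

/-- The index sets of size below two are `∅`, contributing the mean, and the singletons,
contributing the first order term. -/
theorem subsampleMean_sub_eq (hk : BddMeasurable k) (hmn : m ≤ n) (x : Fin n → E) :
    subsampleMean k n x
        - (∫ y, k y ∂(Measure.pi fun _ => P) + hoeffdingTerm P (subsampleMean k n) 1 x)
      = ∑ I : Finset (Fin n) with 2 ≤ I.card, hoeffdingComponent P (subsampleMean k n) I x := by
  classical
  have h := sum_hoeffdingComponent P (f := subsampleMean k n) x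
  rw [← Finset.sum_filter_add_sum_filter_not _ (fun I : Finset (Fin n) => 2 ≤ I.card)] at h
  have hlow : (Finset.univ.filter fun I : Finset (Fin n) => ¬ 2 ≤ I.card)
      = insert ∅ (Finset.powersetCard 1 Finset.univ) := by
    ext I
    simp only [Finset.mem_filter, Finset.mem_univ, true_and, Finset.mem_insert,
      Finset.mem_powersetCard, Finset.subset_univ, ← Finset.card_eq_zero]
    omega
  rw [hlow, Finset.sum_insert (by simp), hoeffdingComponent_empty,
    integral_subsampleMean P hk hmn] at h
  unfold hoeffdingTerm
  linarith

/-- Chebyshev's inequality; the scale `a` cancels, so the bound is uniform in `n` when `a = m/n`. -/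
theorem measure_lt_abs_le_of_integral_sq_le {Ω : Type*} [MeasurableSpace Ω] {μ : Measure Ω}
    [IsProbabilityMeasure μ] {Y : Ω → ℝ} (hY : Integrable (fun ω => Y ω ^ 2) μ) {b M a : ℝ}
    (hb : ∫ ω, Y ω ^ 2 ∂μ ≤ (b * a) ^ 2) (hM : 0 < M) (ha : 0 < a) :
    μ {ω | M * a < |Y ω|} ≤ ENNReal.ofReal (b ^ 2 / M ^ 2) := by
  have h := mul_meas_ge_le_integral_of_nonneg (Eventually.of_forall fun ω => sq_nonneg (Y ω)) hY
    ((M * a) ^ 2)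
  have hle : μ.real {ω | (M * a) ^ 2 ≤ Y ω ^ 2} ≤ b ^ 2 / M ^ 2 := by
    rw [le_div_iff₀ (by positivity)]
    have : μ.real {ω | (M * a) ^ 2 ≤ Y ω ^ 2} * M ^ 2 * a ^ 2 ≤ b ^ 2 * a ^ 2 := by
      calc _ = (M * a) ^ 2 * μ.real {ω | (M * a) ^ 2 ≤ Y ω ^ 2} := by ring
        _ ≤ (b * a) ^ 2 := h.trans hb
        _ = _ := by ring
    exact le_of_mul_le_mul_right this (by positivity)
  calc μ {ω | M * a < |Y ω|} ≤ μ {ω | (M * a) ^ 2 ≤ Y ω ^ 2} := measure_mono fun ω hω => by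
        rw [Set.mem_ofPred_eq, ← sq_abs (Y ω)]
        exact pow_le_pow_left₀ (by positivity) (le_of_lt hω) 2
    _ = ENNReal.ofReal (μ.real {ω | (M * a) ^ 2 ≤ Y ω ^ 2}) := (ofReal_measureReal).symm
    _ ≤ _ := ENNReal.ofReal_le_ofReal hle

end Subsample


/-! ### The stochastic expansion -/

theorem mainTheorem12
    {E S Ω : Type*} [MeasurableSpace E] [MeasurableSpace Ω]
    (P : Measure E) [IsProbabilityMeasure P] (μ : Measure Ω) [IsProbabilityMeasure μ]
    (X : ℕ → Ω → E) (hXlaw : ∀ i, HasLaw (X i) P μ) (hXindep : iIndepFun X μ)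
    (T : (m : ℕ) → (Fin m → E) → Measure E → S) (h : S → ℝ)
    (hTsymm : ∀ (m : ℕ) (σ : Equiv.Perm (Fin m)) (x : Fin m → E),
      T m (fun i => x (σ i)) P = T m x P)
    (hmeas : ∀ m : ℕ, Measurable (statKernel h T P m))
    (hbdd : ∃ C : ℝ, ∀ t, |h t| ≤ C)
    (m : ℕ → ℕ) (hm : Tendsto m atTop atTop)
    (hmn : Tendsto (fun n => (m n : ℝ) / (n : ℝ)) atTop (𝓝 0))
    (c₁ c₂ : ℝ)
    (hcond₁ : ∀ n : ℕ, ∀ i j : Fin (m n), i < j →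
      ∀ᵐ x ∂(Measure.pi fun _ : Fin (m n) => P),
        l2Diff₂ P i j (statKernel h T P (m n)) x ≤ c₁ / (m n : ℝ))
    (hcond₂ : ∀ n : ℕ, ∀ i : Fin (m n),
      ∀ᵐ x ∂(Measure.pi fun _ : Fin (m n) => P),
        l2Diff P i (fun z => statKernel h T P (m n) z
          - hoeffdingTerm P (statKernel h T P (m n)) 0 z
          - hoeffdingTerm P (statKernel h T P (m n)) 1 z) x ≤ c₂) :
    IsBigOInProb μ
      (fun n ω => bootJ h T P (m n) n (fun i : Fin n => X i ω)
        - (bootTheta h T P (m n)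
          + hoeffdingTerm P (bootJ h T P (m n) n) 1 (fun i : Fin n => X i ω)))
      (fun n => (m n : ℝ) / (n : ℝ)) := by
  obtain ⟨C, hC⟩ := hbdd
  intro ε hε
  -- `M` depends only on `C` and `ε`, and is fixed before `n`.
  obtain ⟨M, hM, hMε⟩ : ∃ M : ℝ, 0 < M ∧ ENNReal.ofReal (C ^ 2 / M ^ 2) ≤ ε := by
    have hlim : Tendsto (fun M : ℝ => ENNReal.ofReal (C ^ 2 / M ^ 2)) atTop (𝓝 0) := by
      rw [← ENNReal.ofReal_zero]
      exact ENNReal.tendsto_ofReal ((tendsto_pow_atTop two_ne_zero).const_div_atTop _)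
    exact ((eventually_gt_atTop 0).and (hlim.eventually (Iic_mem_nhds hε))).exists
  refine ⟨M, ?_⟩
  -- The moment bound needs `2 ≤ m ≤ n`; the upper inequality comes from `m/n < 1`, which is
  -- informative only for `n > 0` since division by zero gives zero.
  filter_upwards [hm.eventually_ge_atTop 2, hmn.eventually (Iio_mem_nhds zero_lt_one),
    eventually_gt_atTop 0] with n h2 hlt hn
  have hn' : (0 : ℝ) < n := by exact_mod_cast hn
  have hle : m n ≤ n := by
    have : (m n : ℝ) / n < 1 := hlt
    rw [div_lt_one hn'] at this
    exact_mod_cast this.le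
  have hm' : (0 : ℝ) < m n := by exact_mod_cast (by omega : 0 < m n)
  have hpos : (0 : ℝ) < m n / n := div_pos hm' hn'
  have hk : BddMeasurable (statKernel h T P (m n)) := ⟨hmeas _, C, fun _ => hC _⟩
  set R : (Fin n → E) → ℝ := fun x => ∑ I : Finset (Fin n) with 2 ≤ I.card,
    hoeffdingComponent P (subsampleMean (statKernel h T P (m n)) n) I x with hR
  have hRb : BddMeasurable R :=
    BddMeasurable.sum fun I _ => hk.subsampleMean.hoeffdingComponent P I
  have hXm : AEMeasurable (fun ω (i : Fin n) => X i ω) μ :=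
    aemeasurable_pi_lambda _ fun i => (hXlaw i).aemeasurable
  have hlaw : μ.map (fun ω (i : Fin n) => X i ω) = Measure.pi fun _ => P :=
    map_comp_injective_eq_pi P hXlaw hXindep Fin.val_injective
  have hRint : Integrable (fun x => R x ^ 2) (μ.map fun ω (i : Fin n) => X i ω) := by
    rw [hlaw]
    exact hRb.sq.integrable _
  have hmom : ∫ ω, R (fun i : Fin n => X i ω) ^ 2 ∂μ ≤ (C * (m n / n)) ^ 2 := by
    rw [← integral_map (f := fun x => R x ^ 2) hXm hRb.sq.1.aestronglyMeasurable, hlaw]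
    exact integral_sq_subsampleMean_remainder_le P (hmeas _) (fun _ => hC _) h2 hle
  rw [abs_of_pos hpos]
  have heq : ∀ ω, bootJ h T P (m n) n (fun i : Fin n => X i ω)
        - (bootTheta h T P (m n)
          + hoeffdingTerm P (bootJ h T P (m n) n) 1 (fun i : Fin n => X i ω))
      = R fun i : Fin n => X i ω := fun ω => subsampleMean_sub_eq P hk hle _
  simp_rw [heq]
  exact (measure_lt_abs_le_of_integral_sq_le (hRint.comp_aemeasurable hXm) hmom hM hpos).trans hMε
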